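/- Let $C$ be a non-empty set of colors. An \emph{arena} is a tuple $\mathcal A=(V,V_1,V_2,E)$ where $V=V_1\uplus V_2$ is a non-empty set of vertices of any cardinality ($V_i$ is controlled by player $i$) and $E\subseteq V\times C\times V$ is a set of colored edges, such that every vertex of $V_1$ has an outgoing edge. It is \emph{finite} if $V$ and $E$ are finite, and \emph{one-player} if $V_2=\emptyset$. A \emph{history} is a finite path of $\mathcal A$ (with one empty history for each vertex) and a \emph{play} is an infinite path. A \emph{strategy} of player 1 maps every history ending in a vertex $v\in V_1$ to an edge with source $v$; a play is \emph{consistent} with it if every prefix of the play ending in $V_1$ (the empty prefix included) is followed in the play by the edge that the strategy chooses. An \emph{objective} is a set $W\subseteq C^\omega$. A strategy is \emph{winning from} $v$ for $W$ if every play from $v$ consistent with it has its sequence of colors in $W$; it is \emph{optimal} for $W$ if it is winning from every vertex from which player 1 has a winning strategy. $W$ is \emph{regular} if there is a regular language $A\subseteq C^*$ such that $W$ is either the set $\mathrm{Reach}(A)$ of infinite words having at least one finite prefix in $A$, or the set $\mathrm{Safe}(A)=C^\omega\setminus\mathrm{Reach}(A)$. A \emph{memory structure} is a tuple $\mathcal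 M=(M,m_{\mathrm{init}},\alpha)$ with a set $M$ of states, $m_{\mathrm{init}}\in M$ and $\alpha\colon M\times C\to M$; it is \emph{finite} if $M$ is, and $\alpha^*$ denotes the extension of $\alpha$ to finite words. A strategy $\sigma$ is \emph{based on} $\mathcal M$ if there is a function $f\colon V_1\times M\to E$ such that $\sigma(\gamma)=f(v,\alpha^*(m_{\mathrm{init}},w))$ for every history $\gamma$ ending in a vertex $v\in V_1$ and with sequence of colors $w$. We say that $\mathcal M$ \emph{suffices to play optimally for $W$} in a class of arenas if in every arena of the class player 1 has a strategy that is based on $\mathcal M$ and optimal for $W$. \textbf{Theorem.} Let $W$ be a regular (reachability or safety) objective and let $\mathcal M$ be a finite memory structure. Then $\mathcal M$ suffices to play optimally for $W$ in all arenas if and only if $\mathcal M$ suffices to play optimally for $W$ in all finite one-player arenas. -/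

import Mathlib

/-!
Turn-based games on edge-coloured graphs, (chromatic) memory structures, and regular
reachability / safety objectives over a set `C` of colours.
-/

universe u v w

namespace MemGame

/-- The finite prefix of length `n` of an infinite sequence. -/
def wordPrefix {α : Type u} (x : ℕ → α) (n : ℕ) : List α :=
  (List.range n).map x

section Objectives

variable {C : Type u}

/-- Infinite words over `C` having at least one finite prefix in `A`. -/
def reach (A : Language C) : Set (ℕ → C) :=
  {x | ∃ n, wordPrefix x n ∈ A}

/-- Infinite words over `C` having no finite prefix in `A`. -/
def safe (A : Language C) : Set (ℕ → C) :=
  (reach A)ᶜ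

/-- A regular objective: a regular reachability or a regular safety objective. -/
def IsRegularObjective (W : Set (ℕ → C)) : Prop :=
  ∃ A : Language C, A.IsRegular ∧ (W = reach A ∨ W = safe A)

end Objectives

/-- An arena with colours in `C`: a non-empty set `V` of vertices of arbitrary cardinality,
partitioned into the set `V₁` of vertices of player 1 and its complement, the vertices of
player 2, and a set `E` of coloured edges `(source, colour, target)`.
A strategy of player 1 has to choose an edge in every vertex of `V₁`, so every such vertex is
required to have an outgoing edge (otherwise there would be no strategy at all). -/
structure Arena (C : Type u) where
  V : Type w
  nonempty : Nonempty V
  V₁ : Set V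
  E : Set (V × C × V)
  exists_edge : ∀ x ∈ V₁, ∃ e ∈ E, e.1 = x

namespace Arena

variable {C : Type u}

/-- The vertices of player 2. -/
def V₂ (𝒜 : Arena.{u, w} C) : Set 𝒜.V := 𝒜.V₁ᶜ

/-- Finitely many vertices and finitely many edges. -/
def IsFinite (𝒜 : Arena.{u, w} C) : Prop :=
  Finite 𝒜.V ∧ 𝒜.E.Finite

/-- A one-player arena of player 1: player 2 controls no vertex. -/
def IsOnePlayer (𝒜 : Arena.{u, w} C) : Prop :=
  𝒜.V₂ = ∅

/-- `𝒜.IsPath x l`: the list `l` of edges of `𝒜` is a path that starts in `x`. -/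
def IsPath (𝒜 : Arena.{u, w} C) : 𝒜.V → List (𝒜.V × C × 𝒜.V) → Prop
  | _, [] => True
  | x, e :: l => e ∈ 𝒜.E ∧ e.1 = x ∧ 𝒜.IsPath e.2.2 l

/-- A history: a finite path. The first vertex is recorded so that there is one empty
history for each vertex; for a non-empty history it is the source of the first edge. -/
structure History (𝒜 : Arena.{u, w} C) where
  start : 𝒜.V
  edges : List (𝒜.V × C × 𝒜.V)
  isPath : 𝒜.IsPath start edges

/-- The last vertex of the path `l` that starts in `x`. -/
def pathOut (𝒜 : Arena.{u, w} C) : 𝒜.V → List (𝒜.V × C × 𝒜.V) → 𝒜.V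
  | x, [] => x
  | _, e :: l => 𝒜.pathOut e.2.2 l

/-- The vertex in which a history ends. -/
def History.out {𝒜 : Arena.{u, w} C} (γ : 𝒜.History) : 𝒜.V :=
  𝒜.pathOut γ.start γ.edges

/-- The finite sequence of colours of a history. -/
def History.colors {𝒜 : Arena.{u, w} C} (γ : 𝒜.History) : List C :=
  γ.edges.map fun e => e.2.1

/-- The histories that end in a vertex of player 1. -/
abbrev History₁ (𝒜 : Arena.{u, w} C) : Type (max u w) :=
  {γ : 𝒜.History // γ.out ∈ 𝒜.V₁}

/-- A play: an infinite path. -/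
structure Play (𝒜 : Arena.{u, w} C) where
  edge : ℕ → 𝒜.V × C × 𝒜.V
  edge_mem : ∀ i, edge i ∈ 𝒜.E
  edge_link : ∀ i, (edge i).2.2 = (edge (i + 1)).1

/-- The vertex from which a play starts. -/
def Play.start {𝒜 : Arena.{u, w} C} (π : 𝒜.Play) : 𝒜.V :=
  (π.edge 0).1

/-- The infinite sequence of colours of a play. -/
def Play.colors {𝒜 : Arena.{u, w} C} (π : 𝒜.Play) : ℕ → C :=
  fun i => (π.edge i).2.1

theorem isPath_wordPrefix (𝒜 : Arena.{u, w} C) (j : ℕ) :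
    ∀ f : ℕ → 𝒜.V × C × 𝒜.V, (∀ i, f i ∈ 𝒜.E) → (∀ i, (f i).2.2 = (f (i + 1)).1) →
      𝒜.IsPath (f 0).1 (wordPrefix f j) := by
  induction j with
  | zero => intro f _ _; exact trivial
  | succ j ih =>
    intro f hf hl
    have h := ih (fun i => f (i + 1)) (fun i => hf (i + 1)) (fun i => hl (i + 1))
    have e : wordPrefix f (j + 1) = f 0 :: wordPrefix (fun i => f (i + 1)) j := by
      simp [wordPrefix, List.range_succ_eq_map, Function.comp_def]
    rw [e]
    refine ⟨hf 0, rfl, ?_⟩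
    rw [hl 0]
    exact h

/-- The history formed by the first `j` edges of a play. -/
def Play.take {𝒜 : Arena.{u, w} C} (π : 𝒜.Play) (j : ℕ) : 𝒜.History where
  start := π.start
  edges := wordPrefix π.edge j
  isPath := 𝒜.isPath_wordPrefix j π.edge π.edge_mem π.edge_link

/-- A strategy of player 1: it maps every history that ends in a vertex of player 1 to an edge
whose source is that vertex. -/
structure Strategy (𝒜 : Arena.{u, w} C) where
  next : 𝒜.History₁ → 𝒜.E
  next_in : ∀ γ : 𝒜.History₁, (next γ).1.1 = γ.1.out

/-- A play is consistent with `σ` if after each of its finite prefixes (including the empty one)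
that ends in a vertex of player 1 it continues with the edge chosen by `σ`. -/
def Play.ConsistentWith {𝒜 : Arena.{u, w} C} (π : 𝒜.Play) (σ : 𝒜.Strategy) : Prop :=
  ∀ (j : ℕ) (h : (π.take j).out ∈ 𝒜.V₁), (σ.next ⟨π.take j, h⟩).1 = π.edge j

/-- `σ` is winning from `x` for `W`: all plays from `x` consistent with `σ` have their
sequence of colours in `W`. -/
def Strategy.WinningFrom {𝒜 : Arena.{u, w} C} (σ : 𝒜.Strategy) (x : 𝒜.V)
    (W : Set (ℕ → C)) : Prop :=
  ∀ π : 𝒜.Play, π.start = x → π.ConsistentWith σ → π.colors ∈ W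

/-- `σ` is optimal for `W`: this single strategy is winning from every vertex from which
player 1 has a winning strategy. -/
def Strategy.Optimal {𝒜 : Arena.{u, w} C} (σ : 𝒜.Strategy) (W : Set (ℕ → C)) : Prop :=
  ∀ x : 𝒜.V, (∃ τ : 𝒜.Strategy, τ.WinningFrom x W) → σ.WinningFrom x W

end Arena

/-- A (chromatic) memory structure with state set `M`. -/
structure MemoryStructure (C : Type u) (M : Type v) where
  init : M
  upd : M → C → M

namespace MemoryStructure

variable {C : Type u} {M : Type v}

/-- The extension of the update function to finite words. -/
def updStar (ℳ : MemoryStructure C M) (m : M) (l : List C) : M :=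
  l.foldl ℳ.upd m

end MemoryStructure

/-- `σ` is based on the memory structure `ℳ`: its choices depend only on the current vertex and
on the memory state reached from the initial one by reading the colours seen so far. -/
def Arena.Strategy.BasedOn {C : Type u} {M : Type v} {𝒜 : Arena.{u, w} C} (σ : 𝒜.Strategy)
    (ℳ : MemoryStructure C M) : Prop :=
  ∃ nxt : 𝒜.V₁ → M → 𝒜.E, ∀ γ : 𝒜.History₁,
    σ.next γ = nxt ⟨γ.1.out, γ.2⟩ (ℳ.updStar ℳ.init γ.1.colors)

/-- In the game `(𝒜, W)`, player 1 has an optimal strategy based on `ℳ`. -/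
def MemoryStructure.SufficesIn {C : Type u} {M : Type v} (ℳ : MemoryStructure C M)
    (W : Set (ℕ → C)) (𝒜 : Arena.{u, w} C) : Prop :=
  ∃ σ : 𝒜.Strategy, σ.BasedOn ℳ ∧ σ.Optimal W

end MemGame

/-! Only the passage from finite one-player arenas to all arenas needs work. It goes through two
properties of `ℳ` that mention no arena: `StronglyMonotone` and `ProgressConsistent`.

Both are necessary, since a failure yields a finite one-player arena that defeats `ℳ`. Regularity
makes the witnesses ultimately periodic, so that two of them can be glued at a single vertex where
the memory state alone decides (`stronglyMonotone_of_sufficesIn`,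
`progressConsistent_of_sufficesIn`).

Conversely, by monotony the winning residuals compatible with a vertex and a memory state form a
finite chain. The strategy plays for the least of them, which is contained in the residual of the
word actually read (`exists_basedOn`). For safety this is enough: a lost play makes the actual
residual empty, hence also the tracked one, and an empty residual can be winning only where player 1
forces a dead end of player 2; forcing it contradicts the play being infinite (`sufficesIn_compl`).
For reachability the strategy also decreases an ordinal attractor rank. A lost play must then lower
the tracked residual infinitely often, and a repetition of memory state and residuals gives a
progress cycle; progress consistency makes its iteration win, although the actual residual has not
changed along it (`sufficesIn`). -/

namespace MemGame

/-! ### Residuals and ultimately periodic words -/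

section Words

variable {C : Type u}

@[simp]
theorem length_wordPrefix {α : Type u} (x : ℕ → α) (n : ℕ) : (wordPrefix x n).length = n := by
  simp [wordPrefix]

@[simp]
theorem wordPrefix_zero {α : Type u} (x : ℕ → α) : wordPrefix x 0 = [] := rfl

theorem wordPrefix_succ {α : Type u} (x : ℕ → α) (n : ℕ) :
    wordPrefix x (n + 1) = wordPrefix x n ++ [x n] := by
  simp [wordPrefix, List.range_succ]

theorem wordPrefix_add {α : Type u} (x : ℕ → α) (m n : ℕ) :
    wordPrefix x (m + n) = wordPrefix x m ++ wordPrefix (fun k => x (m + k)) n := by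
  simp [wordPrefix, List.range_add, Function.comp_def]

theorem map_wordPrefix {α : Type u} {β : Type v} (f : α → β) (x : ℕ → α) (n : ℕ) :
    (wordPrefix x n).map f = wordPrefix (fun k => f (x k)) n := by
  simp [wordPrefix, Function.comp_def]

theorem wordPrefix_congr {α : Type u} {x y : ℕ → α} {n : ℕ} (h : ∀ k < n, x k = y k) :
    wordPrefix x n = wordPrefix y n :=
  List.map_congr_left fun k hk => h k (List.mem_range.1 hk)

/-- The infinite word `w x`. -/
def prepend (w : List C) (x : ℕ → C) : ℕ → C :=
  fun n => if h : n < w.length then w[n] else x (n - w.length)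

theorem prepend_of_lt {w : List C} {n : ℕ} (x : ℕ → C) (h : n < w.length) :
    prepend w x n = w[n] := by
  simp [prepend, h]

@[simp]
theorem prepend_length_add (w : List C) (x : ℕ → C) (n : ℕ) :
    prepend w x (w.length + n) = x n := by
  simp [prepend]

@[simp]
theorem prepend_nil (x : ℕ → C) : prepend [] x = x := by
  funext n
  simp [prepend]

theorem prepend_append (w₁ w₂ : List C) (x : ℕ → C) :
    prepend (w₁ ++ w₂) x = prepend w₁ (prepend w₂ x) := by
  funext n
  simp only [prepend, List.length_append, List.getElem_append]
  by_cases h₁ : n < w₁.length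
  · simp [h₁, Nat.lt_add_right]
  · by_cases h₂ : n - w₁.length < w₂.length
    · simp [h₁, h₂, show n < w₁.length + w₂.length by omega]
    · simp [h₁, h₂, show ¬ n < w₁.length + w₂.length by omega, Nat.sub_sub]

theorem wordPrefix_prepend_of_le {w : List C} {n : ℕ} (x : ℕ → C) (h : n ≤ w.length) :
    wordPrefix (prepend w x) n = w.take n := by
  apply List.ext_getElem
  · simp [h]
  · intro k h₁ h₂
    simp at h₁
    simp [wordPrefix, prepend, show k < w.length by omega]

theorem wordPrefix_prepend_length (w : List C) (x : ℕ → C) :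
    wordPrefix (prepend w x) w.length = w := by
  simp [wordPrefix_prepend_of_le x le_rfl]

theorem wordPrefix_prepend_length_add (w : List C) (x : ℕ → C) (n : ℕ) :
    wordPrefix (prepend w x) (w.length + n) = w ++ wordPrefix x n := by
  rw [wordPrefix_add, wordPrefix_prepend_length]
  simp

theorem prepend_wordPrefix_tail (x : ℕ → C) (n : ℕ) :
    prepend (wordPrefix x n) (fun k => x (n + k)) = x := by
  funext k
  by_cases h : k < n
  · simp [prepend, h, wordPrefix]
  · simp [prepend, h, show n + (k - n) = k by omega]

/-- The residual (left quotient) of a set of infinite words by a finite word. -/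
def residual (W : Set (ℕ → C)) (w : List C) : Set (ℕ → C) :=
  {x | prepend w x ∈ W}

theorem mem_residual {W : Set (ℕ → C)} {w : List C} {x : ℕ → C} :
    x ∈ residual W w ↔ prepend w x ∈ W := Iff.rfl

@[simp]
theorem residual_nil (W : Set (ℕ → C)) : residual W [] = W := by
  ext x
  simp [mem_residual]

theorem residual_append (W : Set (ℕ → C)) (w₁ w₂ : List C) :
    residual W (w₁ ++ w₂) = residual (residual W w₁) w₂ := by
  ext x
  simp [mem_residual, prepend_append]

@[simp]
theorem residual_univ (w : List C) : residual (Set.univ : Set (ℕ → C)) w = Set.univ := rfl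

theorem residual_compl (W : Set (ℕ → C)) (w : List C) : residual Wᶜ w = (residual W w)ᶜ := rfl

theorem residual_mono {W W' : Set (ℕ → C)} (h : W ⊆ W') (w : List C) :
    residual W w ⊆ residual W' w := fun _ hx => h hx

theorem tail_mem_residual_wordPrefix {W : Set (ℕ → C)} {x : ℕ → C} (n : ℕ) :
    (fun k => x (n + k)) ∈ residual W (wordPrefix x n) ↔ x ∈ W := by
  rw [mem_residual, prepend_wordPrefix_tail]

theorem residual_wordPrefix_eq_univ_of_le {W : Set (ℕ → C)} {x : ℕ → C} {m n : ℕ} (hmn : m ≤ n)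
    (h : residual W (wordPrefix x m) = Set.univ) : residual W (wordPrefix x n) = Set.univ := by
  obtain ⟨k, rfl⟩ := Nat.exists_eq_add_of_le hmn
  rw [wordPrefix_add, residual_append, h, residual_univ]

/-- Finitely many residuals, and every word of the set has a finite prefix all of whose
continuations are in the set. -/
structure IsRegularOpen (W : Set (ℕ → C)) : Prop where
  finite_residuals : (Set.range (residual W)).Finite
  exists_residual_eq_univ : ∀ x ∈ W, ∃ n, residual W (wordPrefix x n) = Set.univ

/-- By Myhill–Nerode, `A` has finitely many left quotients. The residual by `w` is everything if a
prefix of `w` lies in `A`, and otherwise is determined by the left quotient by `w`. -/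
theorem isRegularOpen_reach {A : Language C} (hA : A.IsRegular) : IsRegularOpen (reach A) := by
  constructor
  · have hfin : (Set.range A.leftQuotient).Finite :=
      Language.isRegular_iff_finite_range_leftQuotient.1 hA
    refine ((hfin.image reach).union (Set.finite_singleton Set.univ)).subset ?_
    rintro _ ⟨w, rfl⟩
    by_cases h : ∃ n ≤ w.length, w.take n ∈ A
    · right
      obtain ⟨n, hn, hA⟩ := h
      refine Set.eq_univ_of_forall fun x => ⟨n, ?_⟩
      rwa [wordPrefix_prepend_of_le x hn]
    · left
      refine ⟨_, ⟨w, rfl⟩, ?_⟩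
      ext x
      constructor
      · rintro ⟨n, hn⟩
        refine ⟨w.length + n, ?_⟩
        rw [wordPrefix_prepend_length_add]
        exact hn
      · rintro ⟨n, hn⟩
        rcases le_total n w.length with hl | hl
        · rw [wordPrefix_prepend_of_le x hl] at hn
          exact absurd ⟨n, hl, hn⟩ h
        · obtain ⟨k, rfl⟩ := Nat.exists_eq_add_of_le hl
          rw [wordPrefix_prepend_length_add] at hn
          exact ⟨k, hn⟩
  · rintro x ⟨n, hn⟩
    refine ⟨n, Set.eq_univ_of_forall fun z => ⟨n, ?_⟩⟩
    rw [wordPrefix_prepend_of_le z (by simp)]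
    rwa [List.take_of_length_le (by simp)]

theorem IsRegularOpen.leftQuotient {W : Set (ℕ → C)} (hW : IsRegularOpen W) (w : List C) :
    IsRegularOpen (residual W w) := by
  constructor
  · refine hW.finite_residuals.subset ?_
    rintro _ ⟨w', rfl⟩
    exact ⟨w ++ w', residual_append _ _ _⟩
  · intro x hx
    obtain ⟨n, hn⟩ := hW.exists_residual_eq_univ _ hx
    refine ⟨n, ?_⟩
    rw [← residual_append, ← wordPrefix_prepend_length_add]
    exact residual_wordPrefix_eq_univ_of_le (Nat.le_add_left _ _) hn

theorem exists_lt_map_eq_of_finite {α : Type*} {s : Set α} (hs : s.Finite) (f : ℕ → α)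
    (hf : ∀ n, f n ∈ s) : ∃ i j, i < j ∧ f i = f j := by
  have := hs.to_subtype
  obtain ⟨i, j, hij, h⟩ := Finite.exists_ne_map_eq_of_infinite (fun n => (⟨f n, hf n⟩ : s))
  have h' : f i = f j := congrArg Subtype.val h
  rcases lt_or_gt_of_ne hij with hlt | hlt
  · exact ⟨i, j, hlt, h'⟩
  · exact ⟨j, i, hlt, h'.symm⟩

/-- The `k`-th position of the walk on `{0, …, j - 1}` which goes from `n` to `n + 1`, except
that it goes from `j - 1` to `i`. -/
def fold (i j : ℕ) : ℕ → ℕ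
  | 0 => 0
  | k + 1 => if fold i j k + 1 = j then i else fold i j k + 1

theorem fold_of_lt (i : ℕ) {j k : ℕ} (h : k < j) : fold i j k = k := by
  induction k with
  | zero => rfl
  | succ k ih =>
    rw [fold, ih (by omega), if_neg (by omega)]

theorem fold_lt {i j : ℕ} (h : i < j) (k : ℕ) : fold i j k < j := by
  induction k with
  | zero => simp [fold]; omega
  | succ k ih =>
    rw [fold]
    split_ifs <;> omega

theorem fold_add_add {i j : ℕ} (h : i < j) (a k : ℕ) :
    fold (i + a) (j + a) (a + k) = a + fold i j k := by
  induction k with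
  | zero => rw [fold_of_lt _ (by omega)]; rfl
  | succ k ih =>
    rw [← Nat.add_assoc, fold, ih, fold]
    split_ifs <;> omega

theorem fold_succ_congr {i j k k' : ℕ} (h : fold i j k = fold i j k') :
    fold i j (k + 1) = fold i j (k' + 1) := by
  rw [fold, fold, h]

theorem eq_of_fold_eq {i j s k : ℕ} (hs : s < i) (h : fold i j k = s) : k = s := by
  induction k generalizing s with
  | zero => exact h
  | succ k ih =>
    rw [fold] at h
    split_ifs at h with h'
    · omega
    · have := @ih (s - 1) (by omega) (by omega)
      omega

theorem prepend_comp_fold (w : List C) (x : ℕ → C) {i j : ℕ} (h : i < j) :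
    (fun k => prepend w x (fold (i + w.length) (j + w.length) k)) =
      prepend w (fun k => x (fold i j k)) := by
  funext k
  by_cases hk : k < w.length
  · rw [fold_of_lt _ (by omega), prepend_of_lt _ hk, prepend_of_lt _ hk]
  · obtain ⟨k, rfl⟩ := Nat.exists_eq_add_of_le (not_lt.1 hk)
    rw [fold_add_add h, prepend_length_add, prepend_length_add]

theorem fold_length_add {i j : ℕ} (h : i < j) (k : ℕ) : fold i j (j + k) = fold i j (i + k) := by
  induction k with
  | zero =>
    obtain ⟨j, rfl⟩ := Nat.exists_eq_succ_of_ne_zero (Nat.ne_zero_of_lt h)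
    change fold i (j + 1) (j + 1) = fold i (j + 1) i
    rw [fold_of_lt _ h, fold, fold_of_lt _ (Nat.lt_succ_self j), if_pos rfl]
  | succ k ih => exact fold_succ_congr ih

/-- A quantity updated letter by letter that agrees at positions `i` and `j` does not notice the
jump back. It is used for residuals and for memory states. -/
theorem apply_wordPrefix_fold {α : Type*} {F : List C → α}
    (hF : ∀ l l' c, F l = F l' → F (l ++ [c]) = F (l' ++ [c])) {x : ℕ → C} {i j : ℕ}
    (h : F (wordPrefix x i) = F (wordPrefix x j)) (n : ℕ) :
    F (wordPrefix (fun k => x (fold i j k)) n) = F (wordPrefix x (fold i j n)) := by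
  induction n with
  | zero => rfl
  | succ n ih =>
    have h' : F (wordPrefix (fun k => x (fold i j k)) (n + 1)) =
        F (wordPrefix x (fold i j n + 1)) := by
      rw [wordPrefix_succ, wordPrefix_succ]
      exact hF _ _ _ ih
    rw [h', fold]
    split_ifs with hj
    · rw [hj, h]
    · rfl

theorem residual_wordPrefix_fold {R : Set (ℕ → C)} {x : ℕ → C} {i j : ℕ}
    (h : residual R (wordPrefix x i) = residual R (wordPrefix x j)) (n : ℕ) :
    residual R (wordPrefix (fun k => x (fold i j k)) n) =
      residual R (wordPrefix x (fold i j n)) :=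
  apply_wordPrefix_fold (F := residual R)
    (fun l l' c hl => by rw [residual_append, hl, residual_append]) h n

/-- Two residuals of a regular open set that can be separated can be separated by an ultimately
periodic word. -/
theorem IsRegularOpen.exists_fold_mem_diff {W : Set (ℕ → C)} (hW : IsRegularOpen W)
    {u u' : List C} {x : ℕ → C} (hx : x ∈ residual W u)
    (hx' : x ∉ residual W u') :
    ∃ i j, 0 < i ∧ i < j ∧ (fun k => x (fold i j k)) ∈ residual W u ∧
      (fun k => x (fold i j k)) ∉ residual W u' := by
  obtain ⟨n, hn⟩ := (hW.leftQuotient u).exists_residual_eq_univ x hx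
  obtain ⟨i, j, hij, heq⟩ := exists_lt_map_eq_of_finite (hW.leftQuotient u').finite_residuals
    (fun k => residual (residual W u') (wordPrefix x (n + 1 + k)))
    (fun k => ⟨_, rfl⟩)
  -- The jump back lands beyond the first `n` letters, which already force membership for `u`; the
  -- extra 1 makes its target positive.
  refine ⟨n + 1 + i, n + 1 + j, by omega, by omega, ?_, fun hmem => ?_⟩
  · rw [← tail_mem_residual_wordPrefix n]
    rw [wordPrefix_congr (y := x) fun k hk => by rw [fold_of_lt _ (by omega)], hn]
    trivial
  -- The folded word meets only residuals of prefixes of `x`, so its acceptance after `u'` would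
  -- force that of `x`.
  · obtain ⟨k, hk⟩ := (hW.leftQuotient u').exists_residual_eq_univ _ hmem
    rw [residual_wordPrefix_fold heq] at hk
    apply hx'
    rw [← tail_mem_residual_wordPrefix, hk]
    trivial

theorem exists_fold_mem_diff_of_or_compl {W : Set (ℕ → C)}
    (hW : IsRegularOpen W ∨ IsRegularOpen Wᶜ)
    {u u' : List C} {x : ℕ → C} (hx : x ∈ residual W u) (hx' : x ∉ residual W u') :
    ∃ i j, 0 < i ∧ i < j ∧ (fun k => x (fold i j k)) ∈ residual W u ∧
      (fun k => x (fold i j k)) ∉ residual W u' := by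
  rcases hW with hW | hW
  · exact hW.exists_fold_mem_diff hx hx'
  · obtain ⟨i, j, hi, hij, h, h'⟩ := hW.exists_fold_mem_diff (u := u') (u' := u) (x := x) hx'
      (by simpa [residual_compl] using hx)
    exact ⟨i, j, hi, hij, by simpa [residual_compl] using h', h⟩

/-- A residual of a regular open set that is stable under a non-empty word `w` and contains the
word `w^ω` is everything. -/
theorem IsRegularOpen.eq_univ_of_residual_eq_self {R : Set (ℕ → C)} (hR : IsRegularOpen R)
    {w : List C} (hw : w ≠ []) (hRw : residual R w = R) {x : ℕ → C}
    (hx : prepend w x = x) (hxR : x ∈ R) : R = Set.univ := by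
  have hpow : ∀ k, residual R (wordPrefix x (k * w.length)) = R := by
    intro k
    induction k with
    | zero => simp
    | succ k ih =>
      rw [Nat.succ_mul, Nat.add_comm, ← hx, wordPrefix_prepend_length_add, residual_append, hRw,
        ih]
  obtain ⟨n, hn⟩ := hR.exists_residual_eq_univ x hxR
  have hlen : 0 < w.length := List.length_pos_iff.2 hw
  -- The prefix made of `n` copies of `w` has length at least `n`, so its residual is everything,
  -- yet it is still `R`.
  rw [← hpow n]
  exact residual_wordPrefix_eq_univ_of_le (Nat.le_mul_of_pos_right n hlen) hn

end Words

end MemGame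

/-! ### Consistent paths and attractors -/

namespace MemGame

namespace Arena

variable {C : Type u} {𝒜 : Arena.{u, w} C}

theorem isPath_concat {x : 𝒜.V} {l : List (𝒜.V × C × 𝒜.V)} {e : 𝒜.V × C × 𝒜.V} :
    𝒜.IsPath x (l ++ [e]) ↔ 𝒜.IsPath x l ∧ e ∈ 𝒜.E ∧ e.1 = 𝒜.pathOut x l := by
  induction l generalizing x with
  | nil => simp [IsPath, pathOut]
  | cons a l ih => simp [IsPath, pathOut, ih, and_assoc]

@[simp]
theorem pathOut_concat (x : 𝒜.V) (l : List (𝒜.V × C × 𝒜.V)) (e : 𝒜.V × C × 𝒜.V) :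
    𝒜.pathOut x (l ++ [e]) = e.2.2 := by
  induction l generalizing x with
  | nil => rfl
  | cons a l ih => exact ih _

theorem Play.out_take (π : 𝒜.Play) (n : ℕ) : (π.take n).out = (π.edge n).1 := by
  cases n with
  | zero => rfl
  | succ n =>
    rw [← π.edge_link n]
    simp [History.out, Play.take, wordPrefix_succ]

theorem Play.colors_take (π : 𝒜.Play) (n : ℕ) :
    (π.take n).colors = wordPrefix π.colors n :=
  map_wordPrefix _ _ _

/-- The list `l` is a path from `x` that is consistent with `τ`. -/
def Strategy.Follows (τ : 𝒜.Strategy) (x : 𝒜.V) (l : List (𝒜.V × C × 𝒜.V)) : Prop :=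
  𝒜.IsPath x l ∧ ∀ l' e, l' ++ [e] <+: l →
    ∀ (h : 𝒜.IsPath x l') (h₁ : 𝒜.pathOut x l' ∈ 𝒜.V₁), (τ.next ⟨⟨x, l', h⟩, h₁⟩).1 = e

theorem Strategy.follows_nil (τ : 𝒜.Strategy) (x : 𝒜.V) : τ.Follows x [] :=
  ⟨trivial, fun l' e h => by simp at h⟩

theorem Strategy.follows_concat {τ : 𝒜.Strategy} {x : 𝒜.V} {l : List (𝒜.V × C × 𝒜.V)}
    {e : 𝒜.V × C × 𝒜.V} :
    τ.Follows x (l ++ [e]) ↔ τ.Follows x l ∧ e ∈ 𝒜.E ∧ e.1 = 𝒜.pathOut x l ∧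
      ∀ (h : 𝒜.IsPath x l) (h₁ : 𝒜.pathOut x l ∈ 𝒜.V₁), (τ.next ⟨⟨x, l, h⟩, h₁⟩).1 = e := by
  constructor
  · rintro ⟨hp, hc⟩
    obtain ⟨hp, he, he'⟩ := isPath_concat.1 hp
    exact ⟨⟨hp, fun l' e' h => hc l' e' (h.trans (List.prefix_append _ _))⟩, he, he',
      hc l e (List.prefix_refl _)⟩
  · rintro ⟨⟨hp, hc⟩, he, he', hn⟩
    refine ⟨isPath_concat.2 ⟨hp, he, he'⟩, fun l' e' h => ?_⟩
    rcases List.prefix_concat_iff.1 h with h | h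
    · obtain ⟨rfl, h⟩ := List.append_inj' h rfl
      obtain rfl : e' = e := by simpa using h
      exact hn
    · exact hc l' e' h

theorem Strategy.Follows.of_prefix {τ : 𝒜.Strategy} {x : 𝒜.V}
    {l l' : List (𝒜.V × C × 𝒜.V)} (h : τ.Follows x l) (hl : l' <+: l) : τ.Follows x l' := by
  induction l using List.reverseRecOn with
  | nil => rw [List.prefix_nil.1 hl]; exact h
  | append_singleton l e ih =>
    rcases List.prefix_concat_iff.1 hl with rfl | hl
    · exact h
    · exact ih (Strategy.follows_concat.1 h).1 hl

theorem exists_seq_of_forall_exists_concat {α : Type*} {J : List α → Prop} (h0 : J [])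
    (hs : ∀ l, J l → ∃ e, J (l ++ [e])) : ∃ f : ℕ → α, ∀ n, J ((List.range n).map f) := by
  choose g hg using hs
  let H : ℕ → {l // J l} := fun n => Nat.rec ⟨[], h0⟩ (fun _ l => ⟨l.1 ++ [g l.1 l.2], hg _ _⟩) n
  refine ⟨fun n => g (H n).1 (H n).2, fun n => ?_⟩
  suffices h : (List.range n).map (fun n => g (H n).1 (H n).2) = (H n).1 by
    rw [h]; exact (H n).2
  induction n with
  | zero => rfl
  | succ n ih => rw [List.range_succ, List.map_append, ih]; rfl

theorem Strategy.exists_play_of_follows {τ : 𝒜.Strategy} {x : 𝒜.V}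
    {f : ℕ → 𝒜.V × C × 𝒜.V} (hf : ∀ n, τ.Follows x (wordPrefix f n)) :
    ∃ π : 𝒜.Play, π.edge = f ∧ π.start = x ∧ π.ConsistentWith τ := by
  have hf' : ∀ n, f n ∈ 𝒜.E ∧ (f n).1 = 𝒜.pathOut x (wordPrefix f n) ∧
      ∀ (h : 𝒜.IsPath x (wordPrefix f n)) (h₁ : 𝒜.pathOut x (wordPrefix f n) ∈ 𝒜.V₁),
        (τ.next ⟨⟨x, wordPrefix f n, h⟩, h₁⟩).1 = f n := by
    intro n
    have := hf (n + 1)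
    rw [wordPrefix_succ] at this
    exact (Strategy.follows_concat.1 this).2
  obtain rfl : (f 0).1 = x := (hf' 0).2.1
  refine ⟨⟨f, fun i => (hf' i).1, fun i => ?_⟩, rfl, rfl, fun j h => (hf' j).2.2 _ h⟩
  rw [(hf' (i + 1)).2.1, wordPrefix_succ, pathOut_concat]

/-- If `B` is a set of positions that player 1 cannot leave and in which player 2 can stay, then
a path consistent with a winning strategy that ends in `B` can be prolonged, inside `B`, to a
play consistent with that strategy. -/
theorem Strategy.WinningFrom.exists_mem_residual {τ : 𝒜.Strategy} {x : 𝒜.V} {W : Set (ℕ → C)}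
    (hτ : τ.WinningFrom x W) {B : 𝒜.V → Set (ℕ → C) → Prop}
    (hB₁ : ∀ v ∈ 𝒜.V₁, ∀ R, B v R → ∀ e ∈ 𝒜.E, e.1 = v → B e.2.2 (residual R [e.2.1]))
    (hB₂ : ∀ v ∉ 𝒜.V₁, ∀ R, B v R → ∃ e ∈ 𝒜.E, e.1 = v ∧ B e.2.2 (residual R [e.2.1]))
    {l₀ : List (𝒜.V × C × 𝒜.V)} (hl₀ : τ.Follows x l₀)
    (hB : B (𝒜.pathOut x l₀) (residual W (l₀.map fun e => e.2.1))) :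
    ∃ z ∈ residual W (l₀.map fun e => e.2.1),
      ∀ n, ∃ v, B v (residual W ((l₀.map fun e => e.2.1) ++ wordPrefix z n)) := by
  -- Invariant of a path built edge by edge: it first retraces `l₀` and from then on stays in `B`.
  let J : List (𝒜.V × C × 𝒜.V) → Prop := fun l => τ.Follows x l ∧ (l <+: l₀ ∨ l₀ <+: l) ∧
    (l₀ <+: l → B (𝒜.pathOut x l) (residual W (l.map fun e => e.2.1)))
  have hJ0 : J [] := by
    refine ⟨τ.follows_nil x, Or.inl (List.nil_prefix), fun h => ?_⟩
    rw [List.prefix_nil.1 h] at hB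
    exact hB
  have hJs : ∀ l, J l → ∃ e, J (l ++ [e]) := by
    rintro l ⟨hl, hp, hBl⟩
    by_cases hpre : l₀ <+: l
    · have hBl := hBl hpre
      by_cases h₁ : 𝒜.pathOut x l ∈ 𝒜.V₁
      · have hsrc := τ.next_in ⟨⟨x, l, hl.1⟩, h₁⟩
        refine ⟨(τ.next ⟨⟨x, l, hl.1⟩, h₁⟩).1, Strategy.follows_concat.2 ⟨hl, Subtype.prop _,
          hsrc, fun _ _ => rfl⟩, Or.inr (hpre.trans (List.prefix_append _ _)), fun _ => ?_⟩
        rw [pathOut_concat, List.map_append, residual_append]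
        exact hB₁ _ h₁ _ hBl _ (Subtype.prop _) hsrc
      · obtain ⟨e, he, hsrc, hBe⟩ := hB₂ _ h₁ _ hBl
        refine ⟨e, Strategy.follows_concat.2 ⟨hl, he, hsrc, fun _ h => absurd h h₁⟩,
          Or.inr (hpre.trans (List.prefix_append _ _)), fun _ => ?_⟩
        rw [pathOut_concat, List.map_append, residual_append]
        exact hBe
    · obtain ⟨t, ht⟩ := hp.resolve_right hpre
      cases t with
      | nil => exact absurd (by simp at ht; rw [ht]) hpre
      | cons e t =>
        have hle : l ++ [e] <+: l₀ := ⟨t, by simpa using ht⟩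
        refine ⟨e, hl₀.of_prefix hle, Or.inl hle, fun h => ?_⟩
        rw [hle.eq_of_length_le h.length_le]
        exact hB
  obtain ⟨f, hf⟩ := exists_seq_of_forall_exists_concat hJ0 hJs
  have hf : ∀ n, J (wordPrefix f n) := hf
  obtain ⟨π, rfl, hstart, hcons⟩ := Strategy.exists_play_of_follows fun n => (hf n).1
  have hmem := hτ π hstart hcons
  have hpre : wordPrefix π.edge l₀.length = l₀ := by
    rcases (hf l₀.length).2.1 with h | h
    · exact h.eq_of_length (by simp)
    · exact (h.eq_of_length (by simp)).symm
  have hcol : ∀ n, (l₀.map fun e => e.2.1) ++ wordPrefix (fun k => π.colors (l₀.length + k)) n =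
      wordPrefix π.colors (l₀.length + n) := by
    intro n
    conv_lhs => rw [← hpre]
    rw [map_wordPrefix, wordPrefix_add, length_wordPrefix]
    rfl
  have hcol0 := hcol 0
  simp only [wordPrefix_zero, List.append_nil, Nat.add_zero] at hcol0
  refine ⟨fun k => π.colors (l₀.length + k), ?_, fun n => ⟨𝒜.pathOut x
    (wordPrefix π.edge (l₀.length + n)), ?_⟩⟩
  · rw [hcol0]
    exact (tail_mem_residual_wordPrefix _).2 hmem
  · rw [hcol]
    have := (hf (l₀.length + n)).2.2 (by
      conv_lhs => rw [← hpre]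
      rw [wordPrefix_add]
      exact List.prefix_append _ _)
    rwa [map_wordPrefix] at this

/-- Player 1 can, within `o` steps, force a residual with property `T` or a dead end. -/
def attractorAt (𝒜 : Arena.{u, w} C) (T : Set (ℕ → C) → Prop) (o : Ordinal.{max u w}) (x : 𝒜.V)
    (R : Set (ℕ → C)) : Prop :=
  T R ∨ (x ∈ 𝒜.V₁ ∧ ∃ e ∈ 𝒜.E, e.1 = x ∧
      ∃ o', ∃ _ : o' < o, 𝒜.attractorAt T o' e.2.2 (residual R [e.2.1])) ∨
    (x ∉ 𝒜.V₁ ∧ ∀ e ∈ 𝒜.E, e.1 = x →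
      ∃ o', ∃ _ : o' < o, 𝒜.attractorAt T o' e.2.2 (residual R [e.2.1]))
termination_by o

/-- Player 1 can force a residual with property `T` or a dead end. -/
def attractor (𝒜 : Arena.{u, w} C) (T : Set (ℕ → C) → Prop) (x : 𝒜.V) (R : Set (ℕ → C)) : Prop :=
  ∃ o, 𝒜.attractorAt T o x R

/-- The least number of steps in which player 1 can force a residual with property `T` or a dead
end. -/
noncomputable def attractorRank (𝒜 : Arena.{u, w} C) (T : Set (ℕ → C) → Prop) (x : 𝒜.V)
    (R : Set (ℕ → C)) : Ordinal.{max u w} :=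
  sInf {o | 𝒜.attractorAt T o x R}

variable {T : Set (ℕ → C) → Prop} {x : 𝒜.V} {R : Set (ℕ → C)}

theorem attractorAt_attractorRank (h : 𝒜.attractor T x R) :
    𝒜.attractorAt T (𝒜.attractorRank T x R) x R :=
  csInf_mem (s := {o | 𝒜.attractorAt T o x R}) h

theorem attractorRank_le {o : Ordinal} (h : 𝒜.attractorAt T o x R) : 𝒜.attractorRank T x R ≤ o :=
  csInf_le' h

theorem attractor_of_target (h : T R) : 𝒜.attractor T x R :=
  ⟨0, by rw [attractorAt]; exact Or.inl h⟩

theorem attractor_of_exists (hx : x ∈ 𝒜.V₁) {e : 𝒜.V × C × 𝒜.V} (he : e ∈ 𝒜.E) (hs : e.1 = x)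
    (h : 𝒜.attractor T e.2.2 (residual R [e.2.1])) : 𝒜.attractor T x R := by
  obtain ⟨o, ho⟩ := h
  refine ⟨Order.succ o, ?_⟩
  rw [attractorAt]
  exact Or.inr (Or.inl ⟨hx, e, he, hs, o, Order.lt_succ o, ho⟩)

theorem attractor_of_forall (hx : x ∉ 𝒜.V₁)
    (h : ∀ e ∈ 𝒜.E, e.1 = x → 𝒜.attractor T e.2.2 (residual R [e.2.1])) :
    𝒜.attractor T x R := by
  -- Player 2 may have infinitely many edges, hence a supremum of ordinals.
  refine ⟨⨆ e : 𝒜.V × C × 𝒜.V, 𝒜.attractorRank T e.2.2 (residual R [e.2.1]) + 1, ?_⟩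
  rw [attractorAt]
  exact Or.inr (Or.inr ⟨hx, fun e he hs => ⟨_, Ordinal.lt_iSup_add_one
    (fun e : 𝒜.V × C × 𝒜.V => 𝒜.attractorRank T e.2.2 (residual R [e.2.1])) e,
    attractorAt_attractorRank (h e he hs)⟩⟩)

theorem exists_edge_attractorRank_lt (h : 𝒜.attractor T x R) (hT : ¬ T R) (hx : x ∈ 𝒜.V₁) :
    ∃ e ∈ 𝒜.E, e.1 = x ∧ 𝒜.attractor T e.2.2 (residual R [e.2.1]) ∧
      𝒜.attractorRank T e.2.2 (residual R [e.2.1]) < 𝒜.attractorRank T x R := by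
  have h' := attractorAt_attractorRank h
  rw [attractorAt] at h'
  rcases h' with h' | ⟨_, e, he, hs, o, ho, ha⟩ | h'
  · exact absurd h' hT
  · exact ⟨e, he, hs, ⟨o, ha⟩, (attractorRank_le ha).trans_lt ho⟩
  · exact absurd hx h'.1

theorem forall_edge_attractorRank_lt (h : 𝒜.attractor T x R) (hT : ¬ T R) (hx : x ∉ 𝒜.V₁)
    {e : 𝒜.V × C × 𝒜.V} (he : e ∈ 𝒜.E) (hs : e.1 = x) :
    𝒜.attractor T e.2.2 (residual R [e.2.1]) ∧
      𝒜.attractorRank T e.2.2 (residual R [e.2.1]) < 𝒜.attractorRank T x R := by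
  have h' := attractorAt_attractorRank h
  rw [attractorAt] at h'
  rcases h' with h' | h' | h'
  · exact absurd h' hT
  · exact absurd h'.1 hx
  · obtain ⟨o, ho, ha⟩ := h'.2 e he hs
    exact ⟨⟨o, ha⟩, (attractorRank_le ha).trans_lt ho⟩

/-- The complement of an attractor is a trap: player 1 has no edge out of it, and player 2 always
has an edge staying in it, so there is no dead end there. -/
theorem Strategy.WinningFrom.exists_mem_residual_not_attractor {τ : 𝒜.Strategy}
    {W : Set (ℕ → C)} (hτ : τ.WinningFrom x W) (T : Set (ℕ → C) → Prop)
    {l₀ : List (𝒜.V × C × 𝒜.V)} (hl₀ : τ.Follows x l₀)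
    (hB : ¬ 𝒜.attractor T (𝒜.pathOut x l₀) (residual W (l₀.map fun e => e.2.1))) :
    ∃ z ∈ residual W (l₀.map fun e => e.2.1),
      ∀ n, ¬ T (residual W ((l₀.map fun e => e.2.1) ++ wordPrefix z n)) := by
  obtain ⟨z, hz, hB⟩ := hτ.exists_mem_residual (B := fun v R => ¬ 𝒜.attractor T v R)
    (fun v hv R h e he hs h' => h (attractor_of_exists hv he hs h'))
    (fun v hv R h => by
      by_contra! hcon
      exact h (attractor_of_forall hv hcon)) hl₀ hB
  refine ⟨z, hz, fun n hT => ?_⟩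
  obtain ⟨v, hv⟩ := hB n
  exact hv (attractor_of_target hT)

end Arena

end MemGame

/-! ### Strategies in arbitrary arenas from monotony and progress -/

namespace MemGame

variable {C : Type u} {M : Type v}

namespace MemoryStructure

theorem updStar_append (ℳ : MemoryStructure C M) (m : M) (w₁ w₂ : List C) :
    ℳ.updStar m (w₁ ++ w₂) = ℳ.updStar (ℳ.updStar m w₁) w₂ := by
  simp [updStar]

/-- Words leading to the same memory state have comparable residuals. -/
def StronglyMonotone (ℳ : MemoryStructure C M) (W : Set (ℕ → C)) : Prop :=
  ∀ w₁ w₂, ℳ.updStar ℳ.init w₁ = ℳ.updStar ℳ.init w₂ →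
    residual W w₁ ⊆ residual W w₂ ∨ residual W w₂ ⊆ residual W w₁

/-- If `w` is a cycle on the memory state reached by `u`, and reading it is a strict progress,
then repeating it forever is winning. -/
def ProgressConsistent (ℳ : MemoryStructure C M) (W : Set (ℕ → C)) : Prop :=
  ∀ u w, ℳ.updStar ℳ.init (u ++ w) = ℳ.updStar ℳ.init u →
    residual W u ⊂ residual W (u ++ w) → ∃ x ∈ residual W u, prepend w x = x

end MemoryStructure

theorem exists_least_of_finite_of_chain {α : Type*} {D : Set (Set α)} (hD : D.Finite)
    (hne : D.Nonempty) (hchain : ∀ X ∈ D, ∀ Y ∈ D, X ⊆ Y ∨ Y ⊆ X) :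
    ∃ X ∈ D, ∀ Y ∈ D, X ⊆ Y := by
  obtain ⟨X, hX⟩ := hD.exists_minimal hne
  refine ⟨X, hX.1, fun Y hY => ?_⟩
  rcases hchain X hX.1 Y hY with h | h
  · exact h
  · exact hX.2 hY h

/-- Let `Win` be a set of positions (vertex, residual) in which player 1 can stay by edges that
satisfy `P`. Playing in each pair (vertex, memory state) such an edge for the least residual in
`Win` is a strategy based on the memory structure. -/
theorem MemoryStructure.StronglyMonotone.exists_basedOn {ℳ : MemoryStructure C M}
    {W : Set (ℕ → C)} (hmono : ℳ.StronglyMonotone W) (hfin : (Set.range (residual W)).Finite)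
    {𝒜 : Arena.{u, w} C} {Win : 𝒜.V → Set (ℕ → C) → Prop}
    {P : 𝒜.V → Set (ℕ → C) → 𝒜.V × C × 𝒜.V → Prop}
    (hV₁ : ∀ v ∈ 𝒜.V₁, ∀ R, Win v R →
      ∃ e ∈ 𝒜.E, e.1 = v ∧ Win e.2.2 (residual R [e.2.1]) ∧ P v R e)
    (hV₂ : ∀ v ∉ 𝒜.V₁, ∀ R, Win v R →
      ∀ e ∈ 𝒜.E, e.1 = v → Win e.2.2 (residual R [e.2.1]) ∧ P v R e) :
    ∃ σ : 𝒜.Strategy, σ.BasedOn ℳ ∧ ∀ π : 𝒜.Play, π.ConsistentWith σ → Win π.start W →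
      ∃ S : ℕ → Set (ℕ → C), S 0 ⊆ W ∧ ∀ n,
        (∃ u, ℳ.updStar ℳ.init u = ℳ.updStar ℳ.init (wordPrefix π.colors n) ∧
          residual W u = S n) ∧
        Win (π.edge n).1 (S n) ∧ S (n + 1) ⊆ residual (S n) [π.colors n] ∧
        P (π.edge n).1 (S n) (π.edge n) := by
  let D : 𝒜.V → M → Set (Set (ℕ → C)) := fun x m =>
    {X | (∃ u, ℳ.updStar ℳ.init u = m ∧ residual W u = X) ∧ Win x X}
  have hleast : ∀ x m, ∃ X, (D x m).Nonempty → X ∈ D x m ∧ ∀ Y ∈ D x m, X ⊆ Y := by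
    intro x m
    by_cases hne : (D x m).Nonempty
    · obtain ⟨X, hX, hX'⟩ := exists_least_of_finite_of_chain
        (Set.Finite.subset hfin (by rintro _ ⟨⟨u, -, rfl⟩, -⟩; exact ⟨u, rfl⟩)) hne (by
          rintro _ ⟨⟨u, hu, rfl⟩, -⟩ _ ⟨⟨u', hu', rfl⟩, -⟩
          exact hmono u u' (hu.trans hu'.symm))
      exact ⟨X, fun _ => ⟨hX, hX'⟩⟩
    · exact ⟨∅, fun h => absurd h hne⟩
  choose L hL using hleast
  have hnxt : ∀ (x : 𝒜.V₁) (m : M), ∃ e : 𝒜.E, e.1.1 = x.1 ∧ ((D x.1 m).Nonempty →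
      Win e.1.2.2 (residual (L x.1 m) [e.1.2.1]) ∧ P x.1 (L x.1 m) e.1) := by
    rintro ⟨x, hx⟩ m
    by_cases hne : (D x m).Nonempty
    · obtain ⟨e, he, hs, h⟩ := hV₁ x hx _ (hL x m hne).1.2
      exact ⟨⟨e, he⟩, hs, fun _ => h⟩
    · obtain ⟨e, he, hs⟩ := 𝒜.exists_edge x hx
      exact ⟨⟨e, he⟩, hs, fun h => absurd h hne⟩
  choose nxt hnxt using hnxt
  refine ⟨⟨fun γ => nxt ⟨γ.1.out, γ.2⟩ (ℳ.updStar ℳ.init γ.1.colors),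
    fun γ => (hnxt _ _).1⟩, ⟨nxt, fun γ => rfl⟩, fun π hπ hwin => ?_⟩
  let m : ℕ → M := fun n => ℳ.updStar ℳ.init (wordPrefix π.colors n)
  have hcons : ∀ n, (D (π.edge n).1 (m n)).Nonempty →
      Win (π.edge n).2.2 (residual (L (π.edge n).1 (m n)) [π.colors n]) ∧
        P (π.edge n).1 (L (π.edge n).1 (m n)) (π.edge n) := by
    intro n hne
    by_cases hv : (π.edge n).1 ∈ 𝒜.V₁
    · have hv' : (π.take n).out ∈ 𝒜.V₁ := by rwa [π.out_take]
      have h₁ : (nxt ⟨(π.take n).out, hv'⟩ (ℳ.updStar ℳ.init (π.take n).colors)).1 = π.edge n :=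
        hπ n hv'
      have h₂ := (hnxt ⟨(π.take n).out, hv'⟩ (ℳ.updStar ℳ.init (π.take n).colors)).2
      rw [h₁] at h₂
      simp only [π.out_take, π.colors_take] at h₂
      exact h₂ hne
    · exact hV₂ _ hv _ (hL _ _ hne).1.2 _ (π.edge_mem n) rfl
  -- The updated least candidate is again a candidate, so the next least one lies below it. This
  -- keeps the candidate sets nonempty.
  have hstep : ∀ n, (D (π.edge n).1 (m n)).Nonempty →
      residual (L (π.edge n).1 (m n)) [π.colors n] ∈ D (π.edge (n + 1)).1 (m (n + 1)) := by
    intro n hne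
    obtain ⟨⟨⟨u, hu, hres⟩, hw⟩, -⟩ := hL _ _ hne
    refine ⟨⟨u ++ [π.colors n], ?_, ?_⟩, ?_⟩
    · simp only [m, wordPrefix_succ, MemoryStructure.updStar_append, hu]
    · rw [residual_append, hres]
    · rw [← π.edge_link n]
      exact (hcons n hne).1
  have hne : ∀ n, (D (π.edge n).1 (m n)).Nonempty := by
    intro n
    induction n with
    | zero => exact ⟨W, ⟨[], rfl, residual_nil W⟩, hwin⟩
    | succ n ih => exact ⟨_, hstep n ih⟩
  exact ⟨fun n => L (π.edge n).1 (m n),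
    (hL _ _ (hne 0)).2 W ⟨⟨[], rfl, residual_nil W⟩, hwin⟩,
    fun n => ⟨(hL _ _ (hne n)).1.1, (hL _ _ (hne n)).1.2,
      (hL _ _ (hne (n + 1))).2 _ (hstep n (hne n)), (hcons n (hne n)).2⟩⟩

theorem subset_residual_wordPrefix {S : ℕ → Set (ℕ → C)} {c : ℕ → C}
    (h : ∀ n, S (n + 1) ⊆ residual (S n) [c n]) (i k : ℕ) :
    S (i + k) ⊆ residual (S i) (wordPrefix (fun n => c (i + n)) k) := by
  induction k with
  | zero => simp
  | succ k ih =>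
    rw [wordPrefix_succ, residual_append]
    exact (h (i + k)).trans (residual_mono ih _)

/-- A regular open objective: strong monotony and progress consistency are sufficient. -/
theorem IsRegularOpen.sufficesIn [Finite M] {ℳ : MemoryStructure C M} {W : Set (ℕ → C)}
    (hW : IsRegularOpen W) (hmono : ℳ.StronglyMonotone W) (hprog : ℳ.ProgressConsistent W)
    (𝒜 : Arena.{u, w} C) : ℳ.SufficesIn W 𝒜 := by
  let T : Set (ℕ → C) → Prop := fun R => R = Set.univ
  obtain ⟨σ, hσ, hS⟩ := hmono.exists_basedOn (𝒜 := 𝒜) hW.finite_residuals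
    (Win := 𝒜.attractor T) (P := fun v R e => R ≠ Set.univ →
      𝒜.attractorRank T e.2.2 (residual R [e.2.1]) < 𝒜.attractorRank T v R)
    (fun v hv R h => by
      by_cases hR : R = Set.univ
      · obtain ⟨e, he, hs⟩ := 𝒜.exists_edge v hv
        exact ⟨e, he, hs, Arena.attractor_of_target (by rw [hR]; rfl), fun h => absurd hR h⟩
      · obtain ⟨e, he, hs, h₁, h₂⟩ := Arena.exists_edge_attractorRank_lt h hR hv
        exact ⟨e, he, hs, h₁, fun _ => h₂⟩)
    (fun v hv R h e he hs => by
      by_cases hR : R = Set.univ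
      · exact ⟨Arena.attractor_of_target (by rw [hR]; rfl), fun h => absurd hR h⟩
      · have := Arena.forall_edge_attractorRank_lt h hR hv he hs
        exact ⟨this.1, fun _ => this.2⟩)
  refine ⟨σ, hσ, ?_⟩
  rintro x ⟨τ, hτ⟩ π rfl hπ
  -- Otherwise some word of `W` would never reach the full residual, against openness.
  have hwin : 𝒜.attractor T π.start W := by
    by_contra hna
    obtain ⟨z, hz, hzT⟩ := hτ.exists_mem_residual_not_attractor T (τ.follows_nil _)
      (by rwa [List.map_nil, residual_nil])
    simp only [List.map_nil, residual_nil, List.nil_append] at hz hzT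
    obtain ⟨n, hn⟩ := hW.exists_residual_eq_univ z hz
    exact hzT n hn
  obtain ⟨S, hS0, hS⟩ := hS π hπ hwin
  by_contra hlose
  let m : ℕ → M := fun n => ℳ.updStar ℳ.init (wordPrefix π.colors n)
  let Rr : ℕ → Set (ℕ → C) := fun n => residual W (wordPrefix π.colors n)
  have hsub : ∀ i k, S (i + k) ⊆ residual (S i) (wordPrefix (fun n => π.colors (i + n)) k) :=
    subset_residual_wordPrefix fun n => (hS n).2.2.1
  have hSR : ∀ n, S n ⊆ Rr n := by
    intro n
    have h := (hsub 0 n).trans (residual_mono hS0 _)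
    simpa using h
  have hRr : ∀ n, Rr n ≠ Set.univ := by
    intro n hn
    apply hlose
    rw [← tail_mem_residual_wordPrefix n]
    change _ ∈ Rr n
    rw [hn]
    trivial
  have hSu : ∀ n, S n ≠ Set.univ := fun n hn => hRr n (Set.univ_subset_iff.1 (hn ▸ hSR n))
  have hdecr : ∀ n, 𝒜.attractorRank T (π.edge (n + 1)).1 (residual (S n) [π.colors n]) <
      𝒜.attractorRank T (π.edge n).1 (S n) := by
    intro n
    rw [← π.edge_link n]
    exact (hS n).2.2.2 (hSu n)
  -- As long as `S` is merely updated by the colours read, the rank strictly decreases, which cannot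
  -- last forever.
  have hinf : ∀ N, ∃ n ≥ N, S (n + 1) ≠ residual (S n) [π.colors n] := by
    by_contra! hcon
    obtain ⟨N, hN⟩ := hcon
    refine WellFounded.not_rel_apply_succ (r := ((· < ·) : Ordinal.{max u w} → _ → Prop))
      (fun k => 𝒜.attractorRank T (π.edge (N + k)).1 (S (N + k))) |>.elim fun k hk => hk ?_
    have := hdecr (N + k)
    rw [← hN (N + k) (by omega)] at this
    exact this
  choose g hg hg' using hinf
  let G : ℕ → ℕ := fun k => Nat.rec (g 0) (fun _ n => g (n + 1)) k
  have hGs : ∀ k, G (k + 1) = g (G k + 1) := fun k => rfl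
  have hGmono : StrictMono G := strictMono_nat_of_lt_succ fun k => by
    rw [hGs]; exact hg _
  have hGne : ∀ k, S (G k + 1) ≠ residual (S (G k)) [π.colors (G k)] := by
    intro k
    cases k with
    | zero => exact hg' 0
    | succ k => exact hg' _
  -- Pigeonhole just after the drops, on memory state, tracked residual and actual residual
  -- together.
  obtain ⟨a, b, hab, heq⟩ := exists_lt_map_eq_of_finite
    (((Set.finite_univ (α := M)).prod (hW.finite_residuals.prod hW.finite_residuals)))
    (fun k => (m (G k + 1), S (G k + 1), Rr (G k + 1)))
    (fun k => ⟨trivial, by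
      obtain ⟨u, -, hu⟩ := (hS (G k + 1)).1
      exact ⟨u, hu⟩, ⟨_, rfl⟩⟩)
  simp only [Prod.mk.injEq] at heq
  obtain ⟨hm, hSeq, hReq⟩ := heq
  have hlt : G a < G b := hGmono hab
  set i := G a + 1 with hi
  obtain ⟨d, hd⟩ : ∃ d, G b = i + d := ⟨G b - i, by omega⟩
  set wd := wordPrefix (fun n => π.colors (i + n)) (d + 1) with hwd
  have hpre : wordPrefix π.colors (G b + 1) = wordPrefix π.colors i ++ wd := by
    rw [hd, Nat.add_assoc, wordPrefix_add]
  -- The segment `wd` ends with the drop at `G b`, so returning to the same `S` means a strict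
  -- progress before that drop.
  have hstrict : S i ⊂ residual (S i) wd := by
    have h₁ : residual (S (G b)) [π.colors (G b)] ⊆ residual (S i) wd := by
      rw [hwd, wordPrefix_succ, residual_append, hd]
      exact residual_mono (hsub i d) _
    have h₂ := (hS (G b)).2.2.1
    rw [hSeq]
    rw [hSeq] at h₁
    exact (LE.le.ssubset_of_ne h₂ (hGne b)).trans_subset h₁
  obtain ⟨u, hu, hus⟩ := (hS i).1
  have hmw : ℳ.updStar ℳ.init (u ++ wd) = ℳ.updStar ℳ.init u := by
    rw [ℳ.updStar_append, hu, ← ℳ.updStar_append, ← hpre]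
    exact hm.symm
  obtain ⟨x, hx, hxw⟩ := hprog u wd hmw (by rw [residual_append, hus]; exact hstrict)
  refine hRr i ((hW.leftQuotient _).eq_univ_of_residual_eq_self (w := wd) ?_ ?_ hxw ?_)
  · intro h
    have := congrArg List.length h
    simp [hwd] at this
  · rw [← residual_append, ← hpre]
    exact hReq.symm
  · exact hSR i (hus ▸ hx)

/-- The complement of a regular open objective: strong monotony is sufficient. -/
theorem IsRegularOpen.sufficesIn_compl {ℳ : MemoryStructure C M} {W : Set (ℕ → C)}
    (hW : IsRegularOpen Wᶜ) (hmono : ℳ.StronglyMonotone W)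
    (𝒜 : Arena.{u, w} C) : ℳ.SufficesIn W 𝒜 := by
  have hfin : (Set.range (residual W)).Finite := by
    refine (hW.finite_residuals.image compl).subset ?_
    rintro _ ⟨w, rfl⟩
    exact ⟨_, ⟨w, rfl⟩, by simp [residual_compl]⟩
  -- With no target, the attractor is the set of vertices from which player 1 forces a dead end. The
  -- residual is then irrelevant and is fixed to `∅`, which every word leaves unchanged.
  let T : Set (ℕ → C) → Prop := fun _ => False
  let Win : 𝒜.V → Set (ℕ → C) → Prop := fun v R => ∃ (x : 𝒜.V) (W' : Set (ℕ → C))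
    (τ : 𝒜.Strategy) (l : List (𝒜.V × C × 𝒜.V)), τ.WinningFrom x W' ∧ τ.Follows x l ∧
      𝒜.pathOut x l = v ∧ residual W' (l.map fun e => e.2.1) = R
  have hWin_empty : ∀ v, Win v ∅ → 𝒜.attractor T v ∅ := by
    rintro v ⟨x, W', τ, l, hτ, hl, rfl, hR⟩
    by_contra hna
    obtain ⟨z, hz, -⟩ := hτ.exists_mem_residual_not_attractor T hl (by rwa [hR])
    rw [hR] at hz
    exact hz
  obtain ⟨σ, hσ, hS⟩ := hmono.exists_basedOn (𝒜 := 𝒜) hfin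
    (Win := fun v R => 𝒜.attractor T v ∅ ∨ Win v R)
    (P := fun v _ e => 𝒜.attractor T v ∅ → 𝒜.attractor T e.2.2 ∅ ∧
      𝒜.attractorRank T e.2.2 ∅ < 𝒜.attractorRank T v ∅)
    (fun v hv R h => by
      by_cases ha : 𝒜.attractor T v ∅
      · obtain ⟨e, he, hs, h₁, h₂⟩ := Arena.exists_edge_attractorRank_lt ha id hv
        exact ⟨e, he, hs, Or.inl h₁, fun _ => ⟨h₁, h₂⟩⟩
      · obtain ⟨x, W', τ, l, hτ, hl, rfl, rfl⟩ := h.resolve_left ha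
        have hsrc := τ.next_in ⟨⟨x, l, hl.1⟩, hv⟩
        refine ⟨(τ.next ⟨⟨x, l, hl.1⟩, hv⟩).1, Subtype.prop _, hsrc,
          Or.inr ⟨x, W', τ, _, hτ, Arena.Strategy.follows_concat.2
            ⟨hl, Subtype.prop _, hsrc, fun _ _ => rfl⟩, Arena.pathOut_concat _ _ _, ?_⟩,
          fun h => absurd h ha⟩
        rw [List.map_append, residual_append]
        rfl)
    (fun v hv R h e he hs => by
      refine ⟨?_, fun ha => Arena.forall_edge_attractorRank_lt ha id hv he hs⟩
      rcases h with ha | ⟨x, W', τ, l, hτ, hl, rfl, rfl⟩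
      · exact Or.inl (Arena.forall_edge_attractorRank_lt ha id hv he hs).1
      · refine Or.inr ⟨x, W', τ, l ++ [e], hτ, Arena.Strategy.follows_concat.2
          ⟨hl, he, hs, fun _ h => absurd h hv⟩, Arena.pathOut_concat _ _ _, ?_⟩
        rw [List.map_append, residual_append]
        rfl)
  refine ⟨σ, hσ, ?_⟩
  rintro x ⟨τ, hτ⟩ π rfl hπ
  obtain ⟨S, hS0, hS⟩ := hS π hπ
    (Or.inr ⟨π.start, W, τ, [], hτ, τ.follows_nil _, rfl, residual_nil W⟩)
  -- Once a dead end can be forced, the strategy lowers the rank at every step, impossible along an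
  -- infinite play.
  have hna : ∀ n, ¬ 𝒜.attractor T (π.edge n).1 ∅ := by
    intro n hn
    have hall : ∀ k, 𝒜.attractor T (π.edge (n + k)).1 ∅ := by
      intro k
      induction k with
      | zero => exact hn
      | succ k ih =>
        have := ((hS (n + k)).2.2.2 ih).1
        rwa [π.edge_link] at this
    refine WellFounded.not_rel_apply_succ (r := ((· < ·) : Ordinal.{max u w} → _ → Prop))
      (fun k => 𝒜.attractorRank T (π.edge (n + k)).1 ∅) |>.elim fun k hk => hk ?_
    have := ((hS (n + k)).2.2.2 (hall k)).2
    rwa [π.edge_link] at this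
  by_contra hlose
  obtain ⟨n, hn⟩ := hW.exists_residual_eq_univ _ hlose
  rw [residual_compl, Set.compl_univ_iff] at hn
  have hsub := subset_residual_wordPrefix (fun n => (hS n).2.2.1) 0 n
  have hSn : S n = ∅ := by
    have := hsub.trans (residual_mono hS0 _)
    simp only [Nat.zero_add] at this
    rw [hn] at this
    exact Set.subset_empty_iff.1 this
  have hw := (hS n).2.1.resolve_left (hna n)
  rw [hSn] at hw
  exact hna n (hWin_empty _ hw)

end MemGame

/-! ### Two-branch arenas and necessity of the two properties -/

namespace MemGame

variable {C : Type u} {M : Type v}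

theorem Arena.IsOnePlayer.mem_V₁ {𝒜 : Arena.{u, w} C} (h : 𝒜.IsOnePlayer) (x : 𝒜.V) :
    x ∈ 𝒜.V₁ := by
  by_contra hx
  exact (h ▸ hx : x ∈ (∅ : Set 𝒜.V))

theorem Arena.Play.take_congr {𝒜 : Arena.{u, w} C} {π π' : 𝒜.Play} {n : ℕ}
    (hs : π.start = π'.start) (he : wordPrefix π.edge n = wordPrefix π'.edge n) :
    π.take n = π'.take n := by
  have h : ∀ γ γ' : 𝒜.History, γ.start = γ'.start → γ.edges = γ'.edges → γ = γ' := by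
    rintro ⟨x, l, h⟩ ⟨x', l', h'⟩ rfl rfl
    rfl
  exact h _ _ hs he

theorem Arena.IsOnePlayer.exists_winningFrom {𝒜 : Arena.{u, w} C} (h : 𝒜.IsOnePlayer)
    {W : Set (ℕ → C)} {π : 𝒜.Play} (hπ : π.colors ∈ W) :
    ∃ τ : 𝒜.Strategy, τ.WinningFrom π.start W := by
  have hex : ∀ γ : 𝒜.History₁, ∃ e : 𝒜.E, e.1.1 = γ.1.out ∧
      ∀ n, γ.1 = π.take n → e.1 = π.edge n := by
    intro γ
    by_cases hγ : ∃ n, γ.1 = π.take n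
    · obtain ⟨n, hn⟩ := hγ
      refine ⟨⟨π.edge n, π.edge_mem n⟩, by rw [hn, π.out_take], fun k hk => ?_⟩
      have : n = k := by
        simpa [Arena.Play.take] using congrArg (fun γ => γ.edges.length) (hn.symm.trans hk)
      rw [this]
    · obtain ⟨e, he, hs⟩ := 𝒜.exists_edge _ γ.2
      exact ⟨⟨e, he⟩, hs, fun n hn => absurd ⟨n, hn⟩ hγ⟩
  choose next hsrc hnext using hex
  refine ⟨⟨next, hsrc⟩, fun π' hstart hcons => ?_⟩
  have hstep : ∀ n, wordPrefix π'.edge n = wordPrefix π.edge n → π'.edge n = π.edge n := by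
    intro n hn
    rw [← hcons n (h.mem_V₁ _)]
    exact hnext _ n (Arena.Play.take_congr hstart hn)
  have hpre : ∀ n, wordPrefix π'.edge n = wordPrefix π.edge n := by
    intro n
    induction n with
    | zero => rfl
    | succ n ih => rw [wordPrefix_succ, wordPrefix_succ, ih, hstep n ih]
  have : π'.colors = π.colors := by
    funext n
    simp only [Arena.Play.colors, hstep n (hpre n)]
  rwa [this]

/-- An ultimately periodic word with a distinguished prefix `entry`: after `entry` comes the word
of length `len` given by `word`, and then forever its part from position `back`. -/
structure Branch (C : Type u) where
  entry : List C
  word : ℕ → C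
  back : ℕ
  len : ℕ
  back_lt : back < len

namespace Branch

/-- The ultimately periodic word of the branch, without `entry`. -/
def loop (b : Branch C) : ℕ → C := fun k => b.word (fold b.back b.len k)

/-- The ultimately periodic word of the branch. -/
def full (b : Branch C) : ℕ → C := prepend b.entry b.loop

/-- The place on the branch after `k` steps. -/
def place (b : Branch C) (k : ℕ) : ℕ := fold (b.back + b.entry.length) (b.len + b.entry.length) k

theorem full_eq (b : Branch C) : b.full = fun k => prepend b.entry b.word (b.place k) :=
  (prepend_comp_fold b.entry b.word b.back_lt).symm

theorem place_lt (b : Branch C) (k : ℕ) : b.place k < b.len + b.entry.length :=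
  fold_lt (Nat.add_lt_add_right b.back_lt _) k

theorem place_of_le (b : Branch C) {k : ℕ} (hk : k ≤ b.entry.length) : b.place k = k :=
  fold_of_lt _ (by have := b.back_lt; omega)

theorem full_congr (b : Branch C) {k k' : ℕ} (h : b.place k = b.place k') :
    b.full k = b.full k' := by
  simp only [full_eq, h]

theorem finite_range_full (b : Branch C) : (Set.range b.full).Finite := by
  refine ((Set.finite_lt_nat (b.len + b.entry.length)).image (prepend b.entry b.word)).subset ?_
  rintro _ ⟨k, rfl⟩
  rw [full_eq]
  exact ⟨_, b.place_lt k, rfl⟩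

/-- The vertex after `k` steps on one of two branches; `none` is the common vertex reached after
`entry`. -/
def vertex (B : Bool → Branch C) (b : Bool) (k : ℕ) : Option (Bool × ℕ) :=
  if (B b).place k = (B b).entry.length then none else some (b, (B b).place k)

theorem vertex_eq_none {B : Bool → Branch C} {b : Bool} {k : ℕ} :
    vertex B b k = none ↔ (B b).place k = (B b).entry.length := by
  simp [vertex]

theorem vertex_entry_length (B : Bool → Branch C) (b : Bool) :
    vertex B b (B b).entry.length = none :=
  vertex_eq_none.2 ((B b).place_of_le le_rfl)

theorem vertex_congr {B : Bool → Branch C} {b : Bool} {k k' : ℕ}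
    (h : (B b).place k = (B b).place k') : vertex B b k = vertex B b k' := by
  simp only [vertex, h]

theorem eq_and_place_eq_of_vertex_eq {B : Bool → Branch C} {b b' : Bool} {k k' : ℕ}
    (h : vertex B b k = vertex B b' k') (hb : b = b' ∨ vertex B b k ≠ none) :
    b = b' ∧ (B b).place k = (B b).place k' := by
  by_cases hn : vertex B b k = none
  · obtain rfl := hb.resolve_right (not_not.2 hn)
    exact ⟨rfl, (vertex_eq_none.1 hn).trans (vertex_eq_none.1 (h ▸ hn)).symm⟩
  · have hn' : vertex B b' k' ≠ none := h ▸ hn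
    simp only [vertex, if_neg (mt vertex_eq_none.2 hn), if_neg (mt vertex_eq_none.2 hn'),
      Option.some.injEq, Prod.mk.injEq] at h
    obtain ⟨rfl, h⟩ := h
    exact ⟨rfl, h⟩

theorem finite_range_vertex (B : Bool → Branch C) :
    {p | ∃ b k, vertex B b k = p}.Finite := by
  refine ((Set.finite_singleton none).union (((Set.finite_univ (α := Bool)).prod
    (Set.finite_lt_nat ((B true).len + (B true).entry.length +
      ((B false).len + (B false).entry.length)))).image some)).subset ?_
  rintro _ ⟨b, k, rfl⟩
  rw [vertex]
  split_ifs
  · exact Or.inl rfl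
  · refine Or.inr ⟨_, ⟨trivial, ?_⟩, rfl⟩
    have := (B b).place_lt k
    cases b <;> simp only [Set.mem_ofPred_eq] <;> omega

/-- The vertices of the arena of two branches. -/
abbrev Vertex (B : Bool → Branch C) : Type w :=
  {p : ULift.{w} (Option (Bool × ℕ)) // ∃ b k, vertex B b k = p.down}

/-- The edge from the vertex after `k` steps on a branch. -/
def edge (B : Bool → Branch C) (b : Bool) (k : ℕ) : Vertex.{u, w} B × C × Vertex.{u, w} B :=
  (⟨⟨vertex B b k⟩, b, k, rfl⟩, (B b).full k, ⟨⟨vertex B b (k + 1)⟩, b, k + 1, rfl⟩)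

/-- A vertex other than the common one has a single outgoing edge, so the only real choice is made
in the common vertex. -/
theorem edge_congr {B : Bool → Branch C} {b b' : Bool} {k k' : ℕ}
    (h : vertex B b k = vertex B b' k') (hb : b = b' ∨ vertex B b k ≠ none) :
    edge.{u, w} B b k = edge B b' k' := by
  obtain ⟨rfl, hp⟩ := eq_and_place_eq_of_vertex_eq h hb
  have hs : vertex B b (k + 1) = vertex B b (k' + 1) := vertex_congr (fold_succ_congr hp)
  simp only [edge, h, hs, (B b).full_congr hp]

/-- The one-player arena made of two branches that are glued together in the vertices reached after
their entry words. -/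
def arena (B : Bool → Branch C) : Arena.{u, w} C where
  V := Vertex.{u, w} B
  nonempty := ⟨⟨⟨vertex B true 0⟩, true, 0, rfl⟩⟩
  V₁ := Set.univ
  E := {e | ∃ b k, edge B b k = e}
  exists_edge := by
    rintro ⟨⟨p⟩, b, k, h⟩ -
    exact ⟨edge B b k, ⟨b, k, rfl⟩, Subtype.ext (ULift.ext _ _ h)⟩

theorem isOnePlayer_arena (B : Bool → Branch C) : (arena.{u, w} B).IsOnePlayer :=
  Set.compl_univ

theorem isFinite_arena (B : Bool → Branch C) : (arena.{u, w} B).IsFinite := by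
  have hV : Finite (arena.{u, w} B).V := by
    have := (finite_range_vertex B).to_subtype
    refine Finite.of_injective (β := {p | ∃ b k, vertex B b k = p})
      (fun p : Vertex.{u, w} B => ⟨p.1.down, p.2⟩) fun p q h => ?_
    exact Subtype.ext (ULift.ext _ _ (congrArg Subtype.val h))
  refine ⟨hV, Set.Finite.subset (Set.finite_univ.prod (Set.Finite.prod
    ((B true).finite_range_full.union (B false).finite_range_full) Set.finite_univ)) ?_⟩
  rintro _ ⟨b, k, rfl⟩
  refine ⟨trivial, ?_, trivial⟩
  cases b
  · exact Or.inr ⟨k, rfl⟩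
  · exact Or.inl ⟨k, rfl⟩

/-- The play that follows one branch. -/
def play (B : Bool → Branch C) (b : Bool) : (arena.{u, w} B).Play where
  edge := edge B b
  edge_mem k := ⟨b, k, rfl⟩
  edge_link _ := rfl

/-- The edges of the branch `b` for `n` steps, and then the edges of the branch `b'` after its entry
word. -/
def switchEdge (B : Bool → Branch C) (b b' : Bool) (n k : ℕ) :
    Vertex.{u, w} B × C × Vertex.{u, w} B :=
  if k < n then edge B b k else edge B b' ((B b').entry.length + (k - n))

theorem switchEdge_of_lt (B : Bool → Branch C) (b b' : Bool) {n k : ℕ} (h : k < n) :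
    switchEdge.{u, w} B b b' n k = edge B b k :=
  if_pos h

theorem switchEdge_of_not_lt (B : Bool → Branch C) (b b' : Bool) {n k : ℕ} (h : ¬ k < n) :
    switchEdge.{u, w} B b b' n k = edge B b' ((B b').entry.length + (k - n)) :=
  if_neg h

theorem switchEdge_link {B : Bool → Branch C} {b b' : Bool} {n : ℕ} (hn : vertex B b n = none)
    (k : ℕ) : (switchEdge.{u, w} B b b' n k).2.2 = (switchEdge B b b' n (k + 1)).1 := by
  by_cases h₁ : k + 1 < n
  · rw [switchEdge_of_lt _ _ _ h₁, switchEdge_of_lt _ _ _ (by omega)]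
    rfl
  · rw [switchEdge_of_not_lt _ _ _ h₁]
    by_cases h₂ : k < n
    · obtain rfl : k + 1 = n := by omega
      rw [switchEdge_of_lt _ _ _ h₂, Nat.sub_self]
      exact Subtype.ext (ULift.ext _ _ (hn.trans (vertex_entry_length B b').symm))
    · rw [switchEdge_of_not_lt _ _ _ h₂, Nat.succ_sub (by omega)]
      rfl

/-- The play that leaves the branch `b` after `n` steps, in the common vertex, for the branch
`b'`. -/
def switchPlay (B : Bool → Branch C) (b b' : Bool) (n : ℕ) (hn : vertex B b n = none) :
    (arena.{u, w} B).Play where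
  edge := switchEdge B b b' n
  edge_mem k := by
    by_cases h : k < n
    · exact ⟨b, k, (switchEdge_of_lt B b b' h).symm⟩
    · exact ⟨b', _, (switchEdge_of_not_lt B b b' h).symm⟩
  edge_link := switchEdge_link hn

theorem colors_play (B : Bool → Branch C) (b : Bool) : (play.{u, w} B b).colors = (B b).full := rfl

theorem colors_switchPlay {B : Bool → Branch C} {b b' : Bool} {n : ℕ}
    (hn : vertex B b n = none) :
    (switchPlay.{u, w} B b b' n hn).colors = prepend (wordPrefix (B b).full n) (B b').loop := by
  funext k
  change (switchEdge.{u, w} B b b' n k).2.1 = _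
  by_cases hk : k < n
  · rw [switchEdge_of_lt _ _ _ hk]
    simp [prepend, hk, wordPrefix, edge]
  · rw [switchEdge_of_not_lt _ _ _ hk]
    simp [prepend, hk, edge, full]

theorem start_switchPlay {B : Bool → Branch C} {b b' : Bool} {n : ℕ}
    (hn : vertex B b n = none) :
    (switchPlay.{u, w} B b b' n hn).start = (play.{u, w} B b).start := by
  change (switchEdge.{u, w} B b b' n 0).1 = (edge B b 0).1
  by_cases h : 0 < n
  · rw [switchEdge_of_lt _ _ _ h]
  · obtain rfl : n = 0 := by omega
    rw [switchEdge_of_not_lt _ _ _ h]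
    exact Subtype.ext (ULift.ext _ _ ((vertex_entry_length B b').trans hn.symm))

/-- A memory structure that suffices in the arena of two branches amounts to the choice of a branch
in the common vertex, for each memory state. -/
theorem exists_choice_of_sufficesIn {ℳ : MemoryStructure C M} {W : Set (ℕ → C)}
    {B : Bool → Branch C} (h : ℳ.SufficesIn W (arena.{u, w} B)) :
    ∃ φ : M → Bool, ∀ π π₀ : (arena.{u, w} B).Play, π₀.start = π.start → π₀.colors ∈ W →
      (∀ n, (π.edge n).1.1.down = none →
        π.edge n = edge B (φ (ℳ.updStar ℳ.init (wordPrefix π.colors n)))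
          (B (φ (ℳ.updStar ℳ.init (wordPrefix π.colors n)))).entry.length) →
      π.colors ∈ W := by
  obtain ⟨σ, ⟨nxt, hnxt⟩, hopt⟩ := h
  let hub : (arena.{u, w} B).V := ⟨⟨none⟩, true, _, vertex_entry_length B true⟩
  -- The guard is needed because `nxt` is unconstrained at memory states that no history ending in
  -- `hub` realizes.
  have hφ : ∀ m : M, ∃ b : Bool, (nxt ⟨hub, trivial⟩ m).1.1 = hub →
      (nxt ⟨hub, trivial⟩ m).1 = edge B b (B b).entry.length := by
    intro m
    obtain ⟨b, k, he⟩ := (nxt ⟨hub, trivial⟩ m).2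
    refine ⟨b, fun hs => ?_⟩
    rw [← he] at hs ⊢
    have hs' : vertex B b k = none := congrArg (fun p => p.1.down) hs
    exact edge_congr (hs'.trans (vertex_entry_length B b).symm) (Or.inl rfl)
  choose φ hφ using hφ
  refine ⟨φ, fun π π₀ hstart hπ₀ hhub => ?_⟩
  refine hopt π.start (hstart ▸ (isOnePlayer_arena B).exists_winningFrom hπ₀) π rfl ?_
  intro n hn
  have hsrc := σ.next_in ⟨π.take n, hn⟩
  rw [π.out_take] at hsrc
  by_cases hv : (π.edge n).1.1.down = none
  · have hv' : (π.edge n).1 = hub := Subtype.ext (ULift.ext _ _ hv)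
    rw [hhub n hv]
    have hσ := hnxt ⟨π.take n, hn⟩
    simp only [π.out_take, π.colors_take, hv'] at hσ
    rw [hσ] at hsrc ⊢
    exact hφ _ (hsrc.trans hv')
  · obtain ⟨b, k, he⟩ := (σ.next ⟨π.take n, hn⟩).2
    obtain ⟨b', k', he'⟩ := π.edge_mem n
    rw [← he, ← he'] at hsrc ⊢
    have hsrc' : vertex B b k = vertex B b' k' := congrArg (fun p => p.1.down) hsrc
    refine edge_congr hsrc' (Or.inr fun hc => hv ?_)
    rw [← he']
    exact hsrc'.symm.trans hc

/-- A play that switches the branch after `entry` for a branch that does not come back to the common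
vertex visits that vertex only once. -/
theorem eq_of_switchEdge_eq_none {B : Bool → Branch C} {b b' : Bool}
    (hb' : 0 < (B b').back) {n : ℕ}
    (h : (switchEdge.{u, w} B b b' (B b).entry.length n).1.1.down = none) : n = (B b).entry.length := by
  by_cases hn : n < (B b).entry.length
  · rw [switchEdge_of_lt _ _ _ hn] at h
    have := vertex_eq_none.1 h
    rw [(B b).place_of_le hn.le] at this
    omega
  · rw [switchEdge_of_not_lt _ _ _ hn] at h
    have := eq_of_fold_eq (by omega) (vertex_eq_none.1 h)
    omega

/-- The play `π₀` shows that the start is winning, so the memory-based choice must win too. As `b'`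
never returns to the common vertex, that choice is consulted once, after the entry word of `b`. -/
theorem switchPlay_mem {ℳ : MemoryStructure C M} {W : Set (ℕ → C)} {B : Bool → Branch C}
    {φ : M → Bool}
    (hφ : ∀ π π₀ : (arena.{u, w} B).Play, π₀.start = π.start → π₀.colors ∈ W →
      (∀ n, (π.edge n).1.1.down = none →
        π.edge n = edge B (φ (ℳ.updStar ℳ.init (wordPrefix π.colors n)))
          (B (φ (ℳ.updStar ℳ.init (wordPrefix π.colors n)))).entry.length) →
      π.colors ∈ W) {b b' : Bool} (hb' : 0 < (B b').back)
    (hm : φ (ℳ.updStar ℳ.init (B b).entry) = b') {π₀ : (arena.{u, w} B).Play}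
    (hstart : π₀.start = (play B b).start) (hπ₀ : π₀.colors ∈ W) :
    (B b').loop ∈ residual W (B b).entry := by
  have hpre : wordPrefix (B b).full (B b).entry.length = (B b).entry :=
    wordPrefix_prepend_length _ _
  have hmem := hφ (switchPlay B b b' _ (vertex_entry_length B b)) π₀
    (hstart.trans (start_switchPlay _).symm) hπ₀ (by
      intro n hn
      obtain rfl := eq_of_switchEdge_eq_none hb' hn
      rw [colors_switchPlay, hpre, wordPrefix_prepend_length, hm]
      refine (switchEdge_of_not_lt B b b' (lt_irrefl _)).trans ?_
      rw [Nat.sub_self, Nat.add_zero])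
  rwa [colors_switchPlay, hpre] at hmem

end Branch

/-- If the residuals of `w₁` and `w₂` are incomparable, each entry word has a winning continuation
that loses after the other. Both words reach the common vertex in the same memory state, so the same
continuation is chosen after both and loses after one. -/
theorem stronglyMonotone_of_sufficesIn {ℳ : MemoryStructure C M} {W : Set (ℕ → C)}
    (hW : IsRegularOpen W ∨ IsRegularOpen Wᶜ)
    (h : ∀ 𝒜 : Arena.{u, w} C, 𝒜.IsFinite → 𝒜.IsOnePlayer → ℳ.SufficesIn W 𝒜) :
    ℳ.StronglyMonotone W := by
  intro w₁ w₂ hm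
  by_contra! hcon
  obtain ⟨h₁, h₂⟩ := hcon
  obtain ⟨x₁, hx₁, hx₁'⟩ := Set.not_subset.1 h₁
  obtain ⟨x₂, hx₂, hx₂'⟩ := Set.not_subset.1 h₂
  obtain ⟨i₁, j₁, hi₁, hij₁, hx₁, hx₁'⟩ := exists_fold_mem_diff_of_or_compl hW hx₁ hx₁'
  obtain ⟨i₂, j₂, hi₂, hij₂, hx₂, hx₂'⟩ := exists_fold_mem_diff_of_or_compl hW hx₂ hx₂'
  let B : Bool → Branch C := fun b =>
    if b then ⟨w₁, x₁, i₁, j₁, hij₁⟩ else ⟨w₂, x₂, i₂, j₂, hij₂⟩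
  obtain ⟨φ, hφ⟩ := Branch.exists_choice_of_sufficesIn
    (h (Branch.arena B) (Branch.isFinite_arena B) (Branch.isOnePlayer_arena B))
  cases hb : φ (ℳ.updStar ℳ.init w₁) with
  | true =>
    exact hx₁' (Branch.switchPlay_mem (b := false) (b' := true) hφ hi₁ (hm ▸ hb) rfl hx₂)
  | false =>
    exact hx₂' (Branch.switchPlay_mem (b := true) (b' := false) hφ hi₂ hb rfl hx₁)

/-- Take `z` winning after `uw` but not after `u`. In an arena reading `u` and then offering the
cycle `w` or the exit `z`, one can win by `uwz`. The memory state is the same at each visit, so the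
choice is constant: leaving at once loses, hence cycling forever must win. -/
theorem progressConsistent_of_sufficesIn {ℳ : MemoryStructure C M} {W : Set (ℕ → C)}
    (hW : IsRegularOpen W ∨ IsRegularOpen Wᶜ)
    (h : ∀ 𝒜 : Arena.{u, w} C, 𝒜.IsFinite → 𝒜.IsOnePlayer → ℳ.SufficesIn W 𝒜) :
    ℳ.ProgressConsistent W := by
  intro u w hm hlt
  obtain ⟨z, hz, hz'⟩ := Set.not_subset.1 hlt.2
  obtain ⟨i, j, hi, hij, hz, hz'⟩ := exists_fold_mem_diff_of_or_compl hW hz hz'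
  have hw : 0 < w.length := by
    rw [List.length_pos_iff]
    rintro rfl
    simp at hlt
  -- In the first branch only the letters `w` of `prepend w z` are used, since it jumps back to 0
  -- after `w.length` steps. The second has an empty entry, hence begins in the common vertex.
  let B : Bool → Branch C := fun b =>
    if b then ⟨u, prepend w z, 0, w.length, hw⟩ else ⟨[], z, i, j, hij⟩
  obtain ⟨φ, hφ⟩ := Branch.exists_choice_of_sufficesIn
    (h (Branch.arena B) (Branch.isFinite_arena B) (Branch.isOnePlayer_arena B))
  have hplace : (B true).place (u.length + w.length) = u.length := by
    change fold (0 + u.length) (w.length + u.length) (u.length + w.length) = u.length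
    have h₁ := fold_length_add (i := 0) (j := w.length) hw 0
    rw [fold_add_add hw]
    simp only [Nat.add_zero] at h₁
    rw [h₁]
    rfl
  have hfix : prepend w (B true).loop = (B true).loop := by
    funext k
    change _ = prepend w z (fold 0 w.length k)
    by_cases hk : k < w.length
    · rw [fold_of_lt _ hk, prepend_of_lt _ hk, prepend_of_lt _ hk]
    · obtain ⟨k, rfl⟩ := Nat.exists_eq_add_of_le (not_lt.1 hk)
      rw [prepend_length_add, fold_length_add hw, Nat.zero_add]
      rfl
  have hwin : (Branch.switchPlay.{u, w} B true false (u.length + w.length)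
      (Branch.vertex_eq_none.2 hplace)).colors ∈ W := by
    rw [Branch.colors_switchPlay]
    have : wordPrefix (B true).full (u.length + w.length) = u ++ w := by
      change wordPrefix (prepend u (B true).loop) _ = _
      rw [wordPrefix_prepend_length_add, ← hfix, wordPrefix_prepend_length]
    rw [this]
    exact hz
  refine ⟨(B true).loop, ?_, hfix⟩
  cases hb : φ (ℳ.updStar ℳ.init u) with
  | false =>
    exact absurd (Branch.switchPlay_mem (b := true) (b' := false) hφ hi hb
      (Branch.start_switchPlay _) hwin) hz'
  | true =>
    refine hφ (Branch.play B true) _ (Branch.start_switchPlay _) hwin fun n hn => ?_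
    have hpl : (B true).place n = u.length := Branch.vertex_eq_none.1 hn
    -- Since `w` is a cycle on the memory state reached by `u`, every return to the common vertex
    -- shows that same state.
    have hmem : ℳ.updStar ℳ.init (wordPrefix (B true).full n) = ℳ.updStar ℳ.init u := by
      rw [Branch.full_eq]
      refine (apply_wordPrefix_fold (F := ℳ.updStar ℳ.init)
        (fun l l' c hl => by rw [ℳ.updStar_append, hl, ℳ.updStar_append]) ?_ n).trans ?_
      · change ℳ.updStar ℳ.init (wordPrefix (prepend u (prepend w z)) (0 + u.length)) =
          ℳ.updStar ℳ.init (wordPrefix (prepend u (prepend w z)) (w.length + u.length))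
        rw [Nat.zero_add, Nat.add_comm, wordPrefix_prepend_length_add, wordPrefix_prepend_length,
          wordPrefix_prepend_length, hm]
      · change ℳ.updStar ℳ.init (wordPrefix (prepend u (prepend w z)) ((B true).place n)) = _
        rw [hpl, wordPrefix_prepend_length]
    rw [Branch.colors_play, hmem, hb]
    exact Branch.edge_congr (hn.trans (Branch.vertex_entry_length B true).symm) (Or.inl rfl)

end MemGame

theorem mainTheorem3 {C : Type u} [Nonempty C] {M : Type v} [Finite M]
    (ℳ : MemGame.MemoryStructure C M) (W : Set (ℕ → C)) (hW : MemGame.IsRegularObjective W) :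
    (∀ 𝒜 : MemGame.Arena.{u, w} C, ℳ.SufficesIn W 𝒜) ↔
      (∀ 𝒜 : MemGame.Arena.{u, w} C, 𝒜.IsFinite → 𝒜.IsOnePlayer → ℳ.SufficesIn W 𝒜) := by
  refine ⟨fun h 𝒜 _ _ => h 𝒜, fun h 𝒜 => ?_⟩
  obtain ⟨A, hA, rfl | rfl⟩ := hW
  · have hW := MemGame.isRegularOpen_reach hA
    exact hW.sufficesIn (MemGame.stronglyMonotone_of_sufficesIn (Or.inl hW) h)
      (MemGame.progressConsistent_of_sufficesIn (Or.inl hW) h) 𝒜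
  · have hW : MemGame.IsRegularOpen (MemGame.safe A)ᶜ := by
      rw [MemGame.safe, compl_compl]
      exact MemGame.isRegularOpen_reach hA
    exact hW.sufficesIn_compl (MemGame.stronglyMonotone_of_sufficesIn (Or.inr hW) h) 𝒜
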